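/- For a basic sequence of integers $n_1,n_2,\dots\ge 2$ and digits $d_k\in\{0,1,\dots,n_k-1\}$ write $\Delta^C_{d_1d_2\dots}=\sum_{k\ge1}\frac{d_k}{n_1n_2\cdots n_k}\in[0,1]$ (the Cantor expansion). If $\xi_1,\xi_2,\dots$ are independent random variables, $\xi_k$ taking the values $0,1,\dots,n_k-1$ with probabilities $p_{0k},p_{1k},\dots,p_{(n_k-1)k}$, put $\xi=\Delta^C_{\xi_1\xi_2\dots}$, and let $\mu_\xi$ and $F_\xi$ be its distribution and its distribution function. For a probability measure $\mu$ on $\mathbb R$ let $\dim_H\mu=\inf\{\dim_H E:\mu(E)=1\}$. A bijection $f:[0,1]\to[0,1]$ is called a DP-transformation if $\dim_H f(E)=\dim_H E$ for every $E\subset[0,1]$. Let $n_k=k+1$ and $B=\{10^s:s=1,2,3,\dots\}$. Let $$p_{ik}=\frac1{k+1}\quad(0\le i\le k)\quad\text{for } k\notin B,$$ $$p_{0k}=\frac1{10^{10^{10^{k}}}},\qquad p_{ik}=\frac1k\Bigl(1-\frac1{10^{10^{10^{k}}}}\Bigr)\quad(1\le i\le k)\quad\text{for } k\in B.$$ Let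 $$V=\Bigl\{\sum_{k\ge1}\frac{\alpha_k}{(k+1)!}\;:\;\alpha_k\in\{0,1,\dots,k\}\text{ for all }k\ge1,\ \alpha_k=0\text{ for all }k\in B\Bigr\}.$$ Then a random variable $\xi$ with these digit distributions exists, and for every such $\xi$: all $p_{ik}$ are positive, $\dim_H\mu_\xi=1$, $\dim_H V=1$ and $\dim_H F_\xi(V)=0$; hence $F_\xi$ is not a DP-transformation. Consequently, if $(n_k)$ is an arithmetic progression with first term at least $2$ and difference at least $1$, the two conditions "$p_{ik}>0$ for all $k\ge1$ and $0\le i\le n_k-1$" and "$\dim_H\mu_\xi=1$" are in general not sufficient for $F_\xi$ to be a DP-transformation. -/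

import Mathlib

noncomputable section

namespace CantorDP

/-- A DP-transformation of `[0,1]`: a bijection of `[0,1]` onto itself that preserves the
Hausdorff dimension of every subset of `[0,1]`. -/
def IsDPTransformation (f : ℝ → ℝ) : Prop :=
  Set.BijOn f (Set.Icc 0 1) (Set.Icc 0 1) ∧
    ∀ E : Set ℝ, E ⊆ Set.Icc 0 1 → dimH E = dimH (f '' E)

/-- The Hausdorff dimension of a probability measure on the line: the infimum of the Hausdorff
dimensions of the (Borel) sets of full measure. -/
def measureDim (μ : MeasureTheory.Measure ℝ) : ENNReal :=
  ⨅ (E : Set ℝ) (_ : MeasurableSet E) (_ : μ E = 1), dimH E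

/-- The value `∑_{k ≥ 1} d_k / (n_1 n_2 ⋯ n_k)` of the Cantor series with basic sequence
`n_1, n_2, …` and digits `d_1, d_2, …`. Sequences are indexed by positions `k ≥ 1`; the entries
at index `0` are never used. -/
def cantorValue (n : ℕ → ℕ) (d : ℕ → ℕ) : ℝ :=
  ∑' k : ℕ, (d (k + 1) : ℝ) / ∏ i ∈ Finset.Icc 1 (k + 1), (n i : ℝ)

/-- `ξ_1, ξ_2, …` are independent random variables on `(Ω, P)`, where `ξ_k` takes the values
`0, 1, …, n_k - 1` with probabilities `p k 0, p k 1, …, p k (n_k - 1)`. -/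
structure IsIndependentDigits (n : ℕ → ℕ) (p : ℕ → ℕ → ℝ) {Ω : Type*} [MeasurableSpace Ω]
    (P : MeasureTheory.Measure Ω) (ξ : ℕ → Ω → ℕ) : Prop where
  measurable : ∀ k, 1 ≤ k → Measurable (ξ k)
  lt_base : ∀ k, 1 ≤ k → ∀ ω, ξ k ω < n k
  prob : ∀ k, 1 ≤ k → ∀ i, i < n k → P.real {ω | ξ k ω = i} = p k i
  indep : ProbabilityTheory.iIndepFun (fun k : ℕ => ξ (k + 1)) P

/-- The law `μ_ξ` of the random variable `ξ = ∑_{k ≥ 1} ξ_k / (n_1 ⋯ n_k)`. -/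
def cantorLaw (n : ℕ → ℕ) {Ω : Type*} [MeasurableSpace Ω]
    (P : MeasureTheory.Measure Ω) (ξ : ℕ → Ω → ℕ) : MeasureTheory.Measure ℝ :=
  P.map (fun ω => cantorValue n (fun k => ξ k ω))

/-- The distribution function `F_ξ` of `ξ`. -/
def cantorCDF (n : ℕ → ℕ) {Ω : Type*} [MeasurableSpace Ω]
    (P : MeasureTheory.Measure Ω) (ξ : ℕ → Ω → ℕ) : ℝ → ℝ :=
  fun x => ProbabilityTheory.cdf (cantorLaw n P ξ) x

/-- The basic sequence is an arithmetic progression with first term at least `2` and positive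
difference. -/
def IsArithmeticBase (n : ℕ → ℕ) : Prop :=
  ∃ a d : ℕ, 2 ≤ a ∧ 1 ≤ d ∧ ∀ k, 1 ≤ k → n k = a + (k - 1) * d

/-- The basic sequence `n_k = k + 1`. -/
def exBase (k : ℕ) : ℕ := k + 1

/-- The exceptional positions `10, 100, 1000, …`. -/
def exPositions : Set ℕ := {k | ∃ s : ℕ, 1 ≤ s ∧ k = 10 ^ s}

open Classical in
/-- `exProb k i` is the probability `p_{ik}` that the `k`-th digit equals `i`, for
`i = 0, 1, …, k`. -/
def exProb (k i : ℕ) : ℝ :=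
  if k ∈ exPositions then
    if i = 0 then 1 / (10 : ℝ) ^ (10 ^ (10 ^ k) : ℕ)
    else (1 - 1 / (10 : ℝ) ^ (10 ^ (10 ^ k) : ℕ)) / (k : ℝ)
  else 1 / ((k : ℝ) + 1)

/-- The set `V` of all values of expansions whose digits at the exceptional positions vanish. -/
def exV : Set ℝ :=
  {x | ∃ d : ℕ → ℕ, (∀ k, 1 ≤ k → d k < exBase k) ∧ (∀ k ∈ exPositions, d k = 0) ∧
    x = cantorValue exBase d}

end CantorDP

end

/-!
The proof compares the law of `ξ` with Hausdorff measures, cylinder by cylinder.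

*Frostman bound.* Fix the first `k` digits. By independence such a cylinder, of length
`1 / (k + 1)!`, has probability at most `exProd k / (k + 1)!`, where `exProd k` collects the bases
at the exceptional positions up to `k`: at every other position each digit has probability
`1 / (j + 1)`, and at the exceptional ones the trivial bound `1` is enough
(`IsSpread.prob_digitNum_eq_le`). There are only about `log₁₀ k` exceptional positions, so
`exProd k` is eventually below any positive power of `k!` (`eventually_exProd_le`), and hence an
interval of small length `r` has mass at most `r ^ s`, for every `s < 1`. By the mass distribution
principle the law is bounded by the `s`-dimensional Hausdorff measure
(`IsSpread.cantorLaw_le_hausdorffMeasure`), so that it has no atoms and every set that it charges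
has dimension at least `1`. This argument uses nothing about the digits at exceptional positions.
It therefore applies to `ξ`, which gives `measureDim = 1`, and equally to the variable obtained
from `ξ` by replacing all the exceptional digits by `0`, whose law lives on `exV`, which gives
`dimH exV = 1`.

*Collapse.* If `k` is exceptional, `exV` is covered by the `k!` cylinders of rank `k` whose last
digit is `0`. Each of them has probability at most `exProb k 0`, so the distribution function maps
it into an interval of at most that length (`cantorCDF_sub_le`). Since
`k! * (exProb k 0) ^ s → 0` for every `s > 0` (`tendsto_factorial_mul_rpow`), the image of `exV`
has dimension `0`.
-/

namespace CantorDP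

open Filter Topology MeasureTheory ProbabilityTheory

/-! ### Partial sums of factorial series -/

/-- The numerator of the `k`-th partial sum, over the denominator `(k + 1)!`, of the Cantor
series with basic sequence `exBase` and digits `d`. -/
def digitNum (d : ℕ → ℕ) : ℕ → ℕ
  | 0 => 0
  | k + 1 => (k + 2) * digitNum d k + d (k + 1)

lemma prod_exBase (k : ℕ) :
    ∏ i ∈ Finset.Icc 1 k, (exBase i : ℝ) = ((k + 1).factorial : ℝ) := by
  induction k with
  | zero => simp
  | succ k ih =>
    rw [Finset.prod_Icc_succ_top (by omega), ih, Nat.factorial_succ (k + 1)]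
    simp only [exBase]
    push_cast
    ring

lemma digitNum_div_factorial_succ (d : ℕ → ℕ) (k : ℕ) :
    (digitNum d (k + 1) : ℝ) / ((k + 2).factorial : ℝ) =
      digitNum d k / ((k + 1).factorial : ℝ) + d (k + 1) / ((k + 2).factorial : ℝ) := by
  have h : ((k + 1).factorial : ℝ) ≠ 0 := by positivity
  rw [Nat.factorial_succ (k + 1)]
  simp only [digitNum]
  push_cast
  field_simp
  ring

lemma sum_cantorValue_terms (d : ℕ → ℕ) (K : ℕ) :
    ∑ k ∈ Finset.range K, (d (k + 1) : ℝ) / ∏ i ∈ Finset.Icc 1 (k + 1), (exBase i : ℝ) =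
      digitNum d K / ((K + 1).factorial : ℝ) := by
  induction K with
  | zero => simp [digitNum]
  | succ K ih => rw [Finset.sum_range_succ, ih, prod_exBase, digitNum_div_factorial_succ]

lemma monotone_digitNum_div (d : ℕ → ℕ) :
    Monotone fun k => (digitNum d k : ℝ) / ((k + 1).factorial : ℝ) := by
  refine monotone_nat_of_le_succ fun k => ?_
  rw [digitNum_div_factorial_succ]
  exact le_add_of_nonneg_right (by positivity)

lemma antitone_digitNum_succ_div {d : ℕ → ℕ} (hd : ∀ k, 1 ≤ k → d k < exBase k) :
    Antitone fun k => ((digitNum d k : ℝ) + 1) / ((k + 1).factorial : ℝ) := by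
  refine antitone_nat_of_succ_le fun k => ?_
  have h1 : (d (k + 1) : ℝ) ≤ k + 1 := by
    have := hd (k + 1) (by omega)
    simp only [exBase] at this
    exact_mod_cast Nat.lt_succ_iff.mp this
  have h : (0 : ℝ) < ((k + 1).factorial : ℝ) := by positivity
  rw [Nat.factorial_succ (k + 1), div_le_div_iff₀ (by positivity) h]
  simp only [digitNum]
  push_cast
  nlinarith [mul_le_mul_of_nonneg_left h1 h.le]

lemma digitNum_div_le {d : ℕ → ℕ} (hd : ∀ k, 1 ≤ k → d k < exBase k) (k l : ℕ) :
    (digitNum d k : ℝ) / ((k + 1).factorial : ℝ) ≤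
      ((digitNum d l : ℝ) + 1) / ((l + 1).factorial : ℝ) := by
  refine (monotone_digitNum_div d (le_max_left k l)).trans
    (le_trans ?_ (antitone_digitNum_succ_div hd (le_max_right k l)))
  show _ / _ ≤ _ / _
  gcongr
  linarith

lemma tendsto_digitNum_div {d : ℕ → ℕ} (hd : ∀ k, 1 ≤ k → d k < exBase k) :
    Tendsto (fun k => (digitNum d k : ℝ) / ((k + 1).factorial : ℝ)) atTop
      (𝓝 (cantorValue exBase d)) := by
  have hs : Summable fun k : ℕ =>
      (d (k + 1) : ℝ) / ∏ i ∈ Finset.Icc 1 (k + 1), (exBase i : ℝ) := by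
    refine summable_of_sum_range_le (c := 1) (fun k => by positivity) fun K => ?_
    rw [sum_cantorValue_terms]
    simpa [digitNum] using digitNum_div_le hd K 0
  simpa only [sum_cantorValue_terms, cantorValue] using! hs.hasSum.tendsto_sum_nat

lemma digitNum_div_le_cantorValue {d : ℕ → ℕ} (hd : ∀ k, 1 ≤ k → d k < exBase k) (k : ℕ) :
    (digitNum d k : ℝ) / ((k + 1).factorial : ℝ) ≤ cantorValue exBase d :=
  (monotone_digitNum_div d).ge_of_tendsto (tendsto_digitNum_div hd) k

lemma cantorValue_le_digitNum_succ_div {d : ℕ → ℕ} (hd : ∀ k, 1 ≤ k → d k < exBase k) (k : ℕ) :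
    cantorValue exBase d ≤ ((digitNum d k : ℝ) + 1) / ((k + 1).factorial : ℝ) :=
  le_of_tendsto' (tendsto_digitNum_div hd) fun l => digitNum_div_le hd l k

lemma cantorValue_mem_Icc {d : ℕ → ℕ} (hd : ∀ k, 1 ≤ k → d k < exBase k) :
    cantorValue exBase d ∈ Set.Icc (0 : ℝ) 1 := by
  have h0 := digitNum_div_le_cantorValue hd 0
  have h1 := cantorValue_le_digitNum_succ_div hd 0
  simp [digitNum] at h0 h1
  exact ⟨h0, h1⟩

lemma digitNum_lt_factorial {d : ℕ → ℕ} (hd : ∀ k, 1 ≤ k → d k < exBase k) (k : ℕ) :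
    digitNum d k < (k + 1).factorial := by
  induction k with
  | zero => simp [digitNum]
  | succ k ih =>
    have := hd (k + 1) (by omega)
    simp only [exBase] at this
    rw [Nat.factorial_succ (k + 1), digitNum]
    nlinarith

/-- The numerator of a partial sum determines the digits that it is made of. -/
lemma eq_of_digitNum_eq {d e : ℕ → ℕ} (hd : ∀ k, 1 ≤ k → d k < exBase k)
    (he : ∀ k, 1 ≤ k → e k < exBase k) {k : ℕ} (h : digitNum d k = digitNum e k) :
    ∀ j, 1 ≤ j → j ≤ k → d j = e j := by
  induction k with
  | zero => intro j h1 h2; omega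
  | succ k ih =>
    have hdk : d (k + 1) < k + 2 := hd (k + 1) (by omega)
    have hek : e (k + 1) < k + 2 := he (k + 1) (by omega)
    simp only [digitNum] at h
    have hlast : d (k + 1) = e (k + 1) := by
      have := congrArg (· % (k + 2)) h
      simpa [Nat.mod_eq_of_lt hdk, Nat.mod_eq_of_lt hek] using this
    have hnum : digitNum d k = digitNum e k := by
      rw [hlast] at h
      exact Nat.eq_of_mul_eq_mul_left (by omega) (Nat.add_right_cancel h)
    intro j h1 h2
    rcases Nat.lt_or_ge j (k + 1) with hj | hj
    · exact ih hnum j h1 (by omega)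
    · obtain rfl : j = k + 1 := by omega
      exact hlast

/-! ### Growth of the exceptional product -/

open Classical in
/-- The product of the bases at the exceptional positions up to `k`. -/
noncomputable def exProd (k : ℕ) : ℕ := ∏ j ∈ Finset.Icc 1 k, if j ∈ exPositions then j + 1 else 1

lemma exProd_le (k : ℕ) : exProd k ≤ (k + 1) ^ Nat.log 10 k := by
  classical
  rw [exProd, ← Finset.prod_filter]
  have hsub : (Finset.Icc 1 k).filter (· ∈ exPositions) ⊆
      (Finset.Icc 1 (Nat.log 10 k)).image (10 ^ ·) := by
    intro j hj
    simp only [Finset.mem_filter, Finset.mem_Icc] at hj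
    obtain ⟨⟨h1, h2⟩, s, hs, rfl⟩ := hj
    simp only [Finset.mem_image, Finset.mem_Icc]
    exact ⟨s, ⟨hs, Nat.le_log_of_pow_le (by norm_num) h2⟩, rfl⟩
  have hcard := (Finset.card_le_card hsub).trans Finset.card_image_le
  rw [Nat.card_Icc, Nat.add_sub_cancel] at hcard
  refine (Finset.prod_le_pow_card _ _ (k + 1) fun j hj => ?_).trans
    (Nat.pow_le_pow_right (by omega) hcard)
  simp only [Finset.mem_filter, Finset.mem_Icc] at hj
  omega

/-- The exceptional positions are so sparse that their bases contribute less than any power of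
the full product of bases. -/
lemma eventually_exProd_le {ε : ℝ} (hε : 0 < ε) :
    ∀ᶠ k : ℕ in atTop, 3 * (exProd k : ℝ) ≤ (k.factorial : ℝ) ^ ε := by
  set c := ε * Real.log 2 with hc
  have hc0 : 0 < c := by positivity
  -- `log (3 * exProd k)` is at most of order `log ^ 2 k`, while `log k! ≥ (k - 1) * log 2`.
  have h1 := ((Real.isLittleO_pow_log_id_atTop (n := 2)).comp_tendsto
    (tendsto_atTop_add_const_right atTop (1 : ℝ) tendsto_natCast_atTop_atTop)).def
    (show 0 < c / 4 by positivity)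
  have h2 : ∀ᶠ k : ℕ in atTop, (2 * Real.log 3 / c + 2 : ℝ) ≤ k :=
    tendsto_natCast_atTop_atTop.eventually_ge_atTop _
  filter_upwards [h1, h2, eventually_ge_atTop 1] with k h1 h2 hk
  simp only [Function.comp_apply, id_eq, Real.norm_eq_abs] at h1
  rw [abs_of_nonneg (by positivity), abs_of_nonneg (by positivity)] at h1
  have hlog0 : 0 ≤ Real.log ((k : ℝ) + 1) := Real.log_nonneg (by simp)
  have hlk : (Nat.log 10 k : ℝ) ≤ Real.log (k + 1) := by
    have hpow : (10 : ℝ) ^ Nat.log 10 k ≤ k := by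
      exact_mod_cast Nat.pow_log_le_self 10 (by omega)
    have : (Nat.log 10 k : ℝ) * Real.log 10 ≤ Real.log (k + 1) := by
      rw [← Real.log_pow]
      exact Real.log_le_log (by positivity) (by linarith)
    have h10 : (1 : ℝ) ≤ Real.log 10 := by
      rw [Real.le_log_iff_exp_le (by norm_num)]
      linarith [Real.exp_one_lt_d9]
    nlinarith [Nat.cast_nonneg (α := ℝ) (Nat.log 10 k)]
  have hfac : ((k : ℝ) - 1) * Real.log 2 ≤ Real.log k.factorial := by
    obtain ⟨m, rfl⟩ : ∃ m, k = m + 1 := ⟨k - 1, by omega⟩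
    have : 2 ^ m ≤ (m + 1).factorial := by
      simpa [add_comm] using Nat.factorial_mul_pow_le_factorial (m := 1) (n := m)
    rw [Nat.cast_add_one, add_sub_cancel_right, ← Real.log_pow]
    exact Real.log_le_log (by positivity) (by exact_mod_cast this)
  have hk0 : (0 : ℝ) < k.factorial := by positivity
  calc 3 * (exProd k : ℝ) ≤ 3 * ((k : ℝ) + 1) ^ Nat.log 10 k := by
        gcongr
        exact_mod_cast exProd_le k
    _ = Real.exp (Real.log 3 + Nat.log 10 k * Real.log (k + 1)) := by
        rw [Real.exp_add, Real.exp_log (by norm_num), ← Real.log_pow, Real.exp_log (by positivity)]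
    _ ≤ Real.exp (Real.log k.factorial * ε) := by
        refine Real.exp_le_exp.mpr ?_
        have h3 : Real.log 3 + c * 2 / 2 ≤ c * k / 2 := by
          have := mul_le_mul_of_nonneg_left h2 hc0.le
          rw [mul_add, mul_div_cancel₀ _ hc0.ne'] at this
          linarith
        have h5 : 0 ≤ Real.log 3 := Real.log_nonneg (by norm_num)
        have h4 := mul_le_mul_of_nonneg_right hlk hlog0
        have h6 := mul_le_mul_of_nonneg_right hfac hε.le
        nlinarith
    _ = (k.factorial : ℝ) ^ ε := (Real.rpow_def_of_pos hk0 ε).symm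

/-! ### Spread digits and the mass distribution principle -/

/-- Independent digits of a factorial series none of whose values is more likely than under the
uniform distribution, except possibly at the exceptional positions. -/
structure IsSpread {Ω : Type*} [MeasurableSpace Ω] (P : Measure Ω) (ξ : ℕ → Ω → ℕ) : Prop where
  measurable : ∀ k, 1 ≤ k → Measurable (ξ k)
  lt_base : ∀ k, 1 ≤ k → ∀ ω, ξ k ω < exBase k
  prob_le : ∀ k, 1 ≤ k → k ∉ exPositions → ∀ i, P.real {ω | ξ k ω = i} ≤ 1 / ((k : ℝ) + 1)
  indep : iIndepFun (fun k : ℕ => ξ (k + 1)) P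

section

variable {Ω : Type*} [MeasurableSpace Ω] {P : Measure Ω} {ξ : ℕ → Ω → ℕ}

lemma measurable_digitNum (hm : ∀ k, 1 ≤ k → Measurable (ξ k)) (k : ℕ) :
    Measurable fun ω => digitNum (fun j => ξ j ω) k := by
  induction k with
  | zero => exact measurable_const
  | succ k ih => exact (ih.const_mul (k + 2)).add (hm (k + 1) (by omega))

lemma measurable_cantorValue (hm : ∀ k, 1 ≤ k → Measurable (ξ k))
    (hlt : ∀ k, 1 ≤ k → ∀ ω, ξ k ω < exBase k) :
    Measurable fun ω => cantorValue exBase fun j => ξ j ω := by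
  refine measurable_of_tendsto_metrizable (f := fun k ω =>
    (digitNum (fun j => ξ j ω) k : ℝ) / ((k + 1).factorial : ℝ)) (fun k => ?_) ?_
  · exact ((measurable_from_nat (f := fun n : ℕ => (n : ℝ))).comp
      (measurable_digitNum hm k)).div_const _
  · exact tendsto_pi_nhds.mpr fun ω => tendsto_digitNum_div fun k hk => hlt k hk ω

namespace IsSpread

variable [IsProbabilityMeasure P]

lemma isProbabilityMeasure_cantorLaw (h : IsSpread P ξ) :
    IsProbabilityMeasure (cantorLaw exBase P ξ) :=
  Measure.isProbabilityMeasure_map (measurable_cantorValue h.measurable h.lt_base).aemeasurable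

lemma prob_digitNum_eq_le (h : IsSpread P ξ) (k m : ℕ) :
    P.real {ω | digitNum (fun j => ξ j ω) k = m} ≤ exProd k / ((k + 1).factorial : ℝ) := by
  classical
  rcases Set.eq_empty_or_nonempty {ω | digitNum (fun j => ξ j ω) k = m} with he | ⟨ω₀, hω₀⟩
  · rw [he, measureReal_empty]
    positivity
  have hsub : {ω | digitNum (fun j => ξ j ω) k = m} ⊆
      ⋂ i ∈ Finset.range k, ξ (i + 1) ⁻¹' {ξ (i + 1) ω₀} := by
    intro ω hω
    simp only [Set.mem_iInter, Finset.mem_range]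
    intro i hi
    exact eq_of_digitNum_eq (fun k hk => h.lt_base k hk ω) (fun k hk => h.lt_base k hk ω₀)
      (Eq.trans hω (Eq.symm hω₀)) (i + 1) (by omega) (by omega)
  have hprod : P.real (⋂ i ∈ Finset.range k, ξ (i + 1) ⁻¹' {ξ (i + 1) ω₀}) =
      ∏ i ∈ Finset.range k, P.real (ξ (i + 1) ⁻¹' {ξ (i + 1) ω₀}) := by
    rw [measureReal_def, h.indep.measure_inter_preimage_eq_mul (Finset.range k)
      (sets := fun i => {ξ (i + 1) ω₀}) (fun _ _ => measurableSet_singleton _),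
      ENNReal.toReal_prod]
    rfl
  calc P.real {ω | digitNum (fun j => ξ j ω) k = m}
      ≤ ∏ i ∈ Finset.range k, P.real (ξ (i + 1) ⁻¹' {ξ (i + 1) ω₀}) :=
        (measureReal_mono hsub).trans hprod.le
    _ ≤ ∏ i ∈ Finset.range k,
          ((if i + 1 ∈ exPositions then i + 1 + 1 else 1 : ℕ) : ℝ) / (exBase (i + 1) : ℝ) := by
        refine Finset.prod_le_prod (fun _ _ => measureReal_nonneg) fun i _ => ?_
        split_ifs with hi
        · simp only [exBase]
          rw [div_self (by positivity)]
          exact measureReal_le_one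
        · have h1 := h.prob_le (i + 1) (by omega) hi (ξ (i + 1) ω₀)
          simpa [exBase] using! h1
    _ = exProd k / ((k + 1).factorial : ℝ) := by
        rw [Finset.prod_div_distrib, ← prod_exBase, exProd,
          Finset.range_eq_Ico, Finset.prod_Ico_add' (fun j => (exBase j : ℝ)) 0 k 1,
          Finset.prod_Ico_add' (fun j => ((if j ∈ exPositions then j + 1 else 1 : ℕ) : ℝ)) 0 k 1]
        push_cast
        rfl

/-- An interval of length `r` meets at most `r * (k + 1)! + 2` cylinders of rank `k`. -/
lemma prob_mem_Icc_le (h : IsSpread P ξ) (k : ℕ) (x : ℝ) {r : ℝ} (hr : 0 ≤ r) :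
    P.real {ω | cantorValue exBase (fun j => ξ j ω) ∈ Set.Icc x (x + r)} ≤
      (r * ((k + 1).factorial : ℝ) + 2) * (exProd k / ((k + 1).factorial : ℝ)) := by
  set q : ℝ := ((k + 1).factorial : ℝ) with hq
  have hq0 : 0 < q := by positivity
  set T : Finset ℕ := Finset.Icc ⌈x * q - 1⌉₊ ⌊(x + r) * q⌋₊ with hT
  have hsub : {ω | cantorValue exBase (fun j => ξ j ω) ∈ Set.Icc x (x + r)} ⊆
      ⋃ m ∈ T, {ω | digitNum (fun j => ξ j ω) k = m} := by
    intro ω hω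
    have h1 := digitNum_div_le_cantorValue (fun k hk => h.lt_base k hk ω) k
    have h2 := cantorValue_le_digitNum_succ_div (fun k hk => h.lt_base k hk ω) k
    simp only [Set.mem_iUnion, Set.mem_ofPred_eq, exists_prop, exists_eq_right', hT,
      Finset.mem_Icc]
    constructor
    · have := (le_div_iff₀ hq0).mp (hω.1.trans h2)
      exact Nat.ceil_le.mpr (by linarith)
    · exact Nat.le_floor ((div_le_iff₀ hq0).mp (h1.trans hω.2))
  have hcard : (T.card : ℝ) ≤ r * q + 2 := by
    have hrq : 0 ≤ r * q := by positivity
    rw [hT, Nat.card_Icc]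
    rcases le_total ⌈x * q - 1⌉₊ (⌊(x + r) * q⌋₊ + 1) with hle | hle
    · rw [Nat.cast_sub hle]
      push_cast
      have hc := Nat.le_ceil (x * q - 1)
      rcases le_total 0 ((x + r) * q) with hy | hy
      · have hf := Nat.floor_le hy
        linarith
      · rw [Nat.floor_of_nonpos hy]
        have : (0 : ℝ) ≤ (⌈x * q - 1⌉₊ : ℝ) := by positivity
        push_cast
        linarith
    · rw [Nat.sub_eq_zero_of_le hle]
      push_cast
      linarith
  calc _ ≤ P.real (⋃ m ∈ T, {ω | digitNum (fun j => ξ j ω) k = m}) :=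
        measureReal_mono hsub (measure_ne_top _ _)
    _ ≤ ∑ m ∈ T, P.real {ω | digitNum (fun j => ξ j ω) k = m} :=
        measureReal_biUnion_finset_le _ _
    _ ≤ T.card • (exProd k / q) := Finset.sum_le_card_nsmul _ _ _ fun m _ =>
        h.prob_digitNum_eq_le k m
    _ ≤ _ := by
        rw [nsmul_eq_mul]
        gcongr

lemma exists_prob_mem_Icc_le_rpow (h : IsSpread P ξ) {s : ℝ} (hs : s < 1) :
    ∃ r₀ > 0, ∀ x r : ℝ, 0 < r → r < r₀ →
      P.real {ω | cantorValue exBase (fun j => ξ j ω) ∈ Set.Icc x (x + r)} ≤ r ^ s := by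
  obtain ⟨K, hK⟩ := eventually_atTop.mp (eventually_exProd_le (sub_pos.mpr hs))
  refine ⟨1 / ((K + 1).factorial : ℝ), by positivity, fun x r hr hrK => ?_⟩
  have hex : ∃ k : ℕ, 1 / r ≤ ((k + 1).factorial : ℝ) := by
    obtain ⟨n, hn⟩ := exists_nat_ge (1 / r)
    refine ⟨n, hn.trans ?_⟩
    exact_mod_cast (Nat.le_succ n).trans (Nat.self_le_factorial _)
  -- The rank at which cylinders become shorter than `r`.
  classical
  set k := Nat.find hex with hk
  have hk1 : 1 / r ≤ ((k + 1).factorial : ℝ) := Nat.find_spec hex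
  have hKk : K < k := by
    by_contra! hle
    have h1 : ((k + 1).factorial : ℝ) ≤ ((K + 1).factorial : ℝ) := by
      exact_mod_cast Nat.factorial_le (by omega)
    have h2 : ((K + 1).factorial : ℝ) < 1 / r := by
      rwa [lt_div_iff₀ (by positivity), mul_comm, ← lt_div_iff₀ (by positivity)]
    linarith
  have hk2 : (k.factorial : ℝ) ≤ 1 / r := by
    have := Nat.find_min hex (m := k - 1) (by omega)
    rw [Nat.sub_add_cancel (by omega)] at this
    exact (not_le.mp this).le
  have hrk : 1 ≤ r * ((k + 1).factorial : ℝ) := by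
    rwa [div_le_iff₀ hr, mul_comm] at hk1
  have hq0 : (0 : ℝ) < ((k + 1).factorial : ℝ) := by positivity
  calc _ ≤ (r * ((k + 1).factorial : ℝ) + 2) * (exProd k / ((k + 1).factorial : ℝ)) :=
        h.prob_mem_Icc_le k x hr.le
    _ ≤ (3 * (r * ((k + 1).factorial : ℝ))) * (exProd k / ((k + 1).factorial : ℝ)) := by
        gcongr
        linarith
    _ = r * (3 * exProd k) := by field_simp
    _ ≤ r * (1 / r) ^ (1 - s) := by
        gcongr
        exact (hK k hKk.le).trans
          (Real.rpow_le_rpow (by positivity) hk2 (sub_nonneg.mpr hs.le))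
    _ = r ^ s := by
        rw [one_div, Real.inv_rpow hr.le, ← Real.rpow_neg hr.le]
        nth_rewrite 1 [← Real.rpow_one r]
        rw [← Real.rpow_add hr]
        ring_nf

/-- The mass distribution principle for laws with spread digits. -/
lemma cantorLaw_le_hausdorffMeasure (h : IsSpread P ξ) {s : ℝ} (hs0 : 0 < s) (hs1 : s < 1) :
    cantorLaw exBase P ξ ≤ μH[s] := by
  obtain ⟨r₀, hr₀, hr⟩ := h.exists_prob_mem_Icc_le_rpow hs1
  refine Measure.le_hausdorffMeasure s _ (ENNReal.ofReal (r₀ / 2)) (by simpa using hr₀)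
    fun E hE => ?_
  have hbdd : Bornology.IsBounded E :=
    Metric.isBounded_iff_ediam_ne_top.mpr (hE.trans_lt ENNReal.ofReal_lt_top).ne
  rw [Real.ediam_eq hbdd] at hE ⊢
  have hd : sSup E - sInf E ≤ r₀ / 2 := (ENNReal.ofReal_le_ofReal_iff (by positivity)).mp hE
  set d := sSup E - sInf E with hdef
  have hd0 : 0 ≤ d := by
    rw [hdef, ← Real.diam_eq hbdd]
    exact Metric.diam_nonneg
  rw [ENNReal.ofReal_rpow_of_nonneg hd0 hs0.le]
  -- Compare with intervals of length `r > d` and let `r` decrease to `d`, which may be zero.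
  have hlim : Tendsto (fun r : ℝ => ENNReal.ofReal (r ^ s)) (𝓝[>] d)
      (𝓝 (ENNReal.ofReal (d ^ s))) :=
    (ENNReal.continuous_ofReal.comp (Real.continuous_rpow_const hs0.le)).continuousWithinAt
  refine ge_of_tendsto hlim ?_
  filter_upwards [Ioo_mem_nhdsGT (show d < r₀ by linarith)] with r hr'
  have hE' : E ⊆ Set.Icc (sInf E) (sInf E + r) := fun y hy =>
    ⟨csInf_le hbdd.bddBelow hy, by
      have := le_csSup hbdd.bddAbove hy
      have := hr'.1
      linarith⟩
  refine (measure_mono hE').trans ?_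
  rw [cantorLaw, Measure.map_apply (measurable_cantorValue h.measurable h.lt_base)
    measurableSet_Icc]
  refine (ENNReal.le_ofReal_iff_toReal_le (measure_ne_top _ _)
    (Real.rpow_nonneg (hd0.trans hr'.1.le) s)).mpr ?_
  exact hr (sInf E) r (hd0.trans_lt hr'.1) hr'.2

lemma one_le_dimH_of_cantorLaw_ne_zero (h : IsSpread P ξ) {E : Set ℝ}
    (hE : cantorLaw exBase P ξ E ≠ 0) : 1 ≤ dimH E := by
  refine le_of_forall_lt fun a ha => ?_
  obtain ⟨s, has, hs1⟩ := ENNReal.lt_iff_exists_nnreal_btwn.mp ha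
  refine has.trans_le (le_dimH_of_hausdorffMeasure_ne_zero fun h0 => hE ?_)
  have hs0 : 0 < s := ENNReal.coe_pos.mp (bot_le.trans_lt has)
  refine le_antisymm ?_ bot_le
  rw [← h0]
  exact h.cantorLaw_le_hausdorffMeasure (by exact_mod_cast hs0) (by exact_mod_cast hs1) E

lemma cantorLaw_singleton (h : IsSpread P ξ) (x : ℝ) : cantorLaw exBase P ξ {x} = 0 := by
  by_contra hx
  simpa using h.one_le_dimH_of_cantorLaw_ne_zero hx

lemma measureDim_cantorLaw (h : IsSpread P ξ) : measureDim (cantorLaw exBase P ξ) = 1 := by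
  have := h.isProbabilityMeasure_cantorLaw
  refine le_antisymm ?_ ?_
  · exact (iInf₂_le Set.univ MeasurableSet.univ).trans
      ((iInf_le _ measure_univ).trans Real.dimH_univ.le)
  · exact le_iInf fun E => le_iInf fun _ => le_iInf fun hE =>
      h.one_le_dimH_of_cantorLaw_ne_zero (by simp [hE])

end IsSpread

end

/-! ### The prescribed digit probabilities -/

lemma exProb_zero_of_mem {k : ℕ} (hk : k ∈ exPositions) :
    exProb k 0 = 1 / (10 : ℝ) ^ (10 ^ (10 ^ k) : ℕ) := by
  simp only [exProb, if_pos hk, if_true]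

lemma exProb_of_not_mem {k : ℕ} (hk : k ∉ exPositions) (i : ℕ) :
    exProb k i = 1 / ((k : ℝ) + 1) := by
  simp only [exProb, if_neg hk]

lemma exProb_succ_of_mem {k : ℕ} (hk : k ∈ exPositions) (i : ℕ) :
    exProb k (i + 1) = (1 - exProb k 0) / (k : ℝ) := by
  rw [exProb_zero_of_mem hk]
  simp only [exProb, if_pos hk, Nat.succ_ne_zero, if_false]

lemma exProb_pos {k : ℕ} (hk : 1 ≤ k) (i : ℕ) : 0 < exProb k i := by
  by_cases hB : k ∈ exPositions
  · rcases i with - | i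
    · rw [exProb_zero_of_mem hB]
      positivity
    · have h0 : exProb k 0 < 1 := by
        rw [exProb_zero_of_mem hB, div_lt_one (by positivity)]
        exact one_lt_pow₀ (by norm_num) (by positivity)
      rw [exProb_succ_of_mem hB]
      have : (0 : ℝ) < k := by exact_mod_cast hk
      exact div_pos (sub_pos.mpr h0) this
  · rw [exProb_of_not_mem hB]
    positivity

lemma sum_exProb {k : ℕ} (hk : 1 ≤ k) : ∑ i : Fin (exBase k), exProb k i = 1 := by
  change ∑ i : Fin (k + 1), exProb k i = 1
  have hk0 : (k : ℝ) ≠ 0 := by positivity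
  by_cases hB : k ∈ exPositions
  · rw [Fin.sum_univ_succ]
    simp only [Fin.val_zero, Fin.val_succ, exProb_succ_of_mem hB, Finset.sum_const,
      Finset.card_univ, Fintype.card_fin, nsmul_eq_mul]
    rw [mul_div_cancel₀ _ hk0]
    ring
  · simp only [exProb_of_not_mem hB, Finset.sum_const, Finset.card_univ, Fintype.card_fin,
      nsmul_eq_mul]
    push_cast
    field_simp

lemma exists_isIndependentDigits :
    ∃ (Ω : Type) (_ : MeasurableSpace Ω) (P : Measure Ω) (ξ : ℕ → Ω → ℕ),
      IsProbabilityMeasure P ∧ IsIndependentDigits exBase exProb P ξ := by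
  let q (i : ℕ) : PMF (Fin (exBase (i + 1))) :=
    PMF.ofFintype (fun j => ENNReal.ofReal (exProb (i + 1) j)) (by
      rw [← ENNReal.ofReal_sum_of_nonneg fun j _ => (exProb_pos (by omega) _).le,
        sum_exProb (by omega), ENNReal.ofReal_one])
  obtain ⟨Ω, mΩ, P, X, hX, hlaw, hind, hP⟩ :=
    exists_hasLaw_indepFun (fun i : ℕ => Fin (exBase (i + 1))) fun i => (q i).toMeasure
  refine ⟨Ω, mΩ, P, fun k ω => X (k - 1) ω, hP, ?_, ?_, ?_, ?_⟩
  · intro k _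
    exact (measurable_of_finite (fun j : Fin (exBase (k - 1 + 1)) => (j : ℕ))).comp (hX _)
  · intro k hk ω
    obtain ⟨i, rfl⟩ : ∃ i, k = i + 1 := ⟨k - 1, by omega⟩
    exact (X i ω).isLt
  · intro k hk j hj
    obtain ⟨i, rfl⟩ : ∃ i, k = i + 1 := ⟨k - 1, by omega⟩
    have hset : {ω | ((X (i + 1 - 1) ω : Fin _) : ℕ) = j} = X i ⁻¹' {⟨j, hj⟩} := by
      ext ω
      exact (Fin.ext_iff (a := X i ω) (b := ⟨j, hj⟩)).symm
    rw [hset, measureReal_def, ← Measure.map_apply (hX i) (measurableSet_singleton _),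
      (hlaw i).map_eq, PMF.toMeasure_apply_singleton _ _ (measurableSet_singleton _)]
    simp only [q, PMF.ofFintype_apply]
    exact ENNReal.toReal_ofReal (exProb_pos (by omega) _).le
  · exact hind.comp (fun i (j : Fin (exBase (i + 1))) => (j : ℕ)) fun i => measurable_of_finite _

section

variable {Ω : Type*} [MeasurableSpace Ω] {P : Measure Ω} {ξ : ℕ → Ω → ℕ}

namespace IsIndependentDigits

lemma isSpread (h : IsIndependentDigits exBase exProb P ξ) : IsSpread P ξ where
  measurable := h.measurable
  lt_base := h.lt_base
  indep := h.indep
  prob_le k hk hB i := by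
    by_cases hi : i < exBase k
    · rw [h.prob k hk i hi, exProb_of_not_mem hB]
    · have : {ω | ξ k ω = i} = ∅ :=
        Set.eq_empty_of_forall_notMem fun ω hω => hi (hω ▸ h.lt_base k hk ω)
      rw [this, measureReal_empty]
      positivity

/-! ### The dimension of the exceptional set -/

open Classical in
/-- Replacing the digits at the exceptional positions by zero gives a law that is carried by
`exV` and still has spread digits. -/
lemma isSpread_zeroed (h : IsIndependentDigits exBase exProb P ξ) :
    IsSpread P fun k ω => if k ∈ exPositions then 0 else ξ k ω where
  measurable k hk := by
    by_cases hB : k ∈ exPositions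
    · simp only [hB, if_true, measurable_const]
    · simpa only [hB, if_false] using h.measurable k hk
  lt_base k hk ω := by
    split_ifs
    · simp [exBase]
    · exact h.lt_base k hk ω
  prob_le k hk hB i := by
    simpa only [hB, if_false] using h.isSpread.prob_le k hk hB i
  indep := h.indep.comp (fun k j => if k + 1 ∈ exPositions then 0 else j)
    fun _ => measurable_of_countable _

end IsIndependentDigits

lemma dimH_exV : dimH exV = 1 := by
  classical
  obtain ⟨Ω, mΩ, P, ξ, hP, h⟩ := exists_isIndependentDigits
  refine le_antisymm ((dimH_mono (Set.subset_univ _)).trans Real.dimH_univ.le) ?_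
  refine h.isSpread_zeroed.one_le_dimH_of_cantorLaw_ne_zero fun h0 => ?_
  have hle := Measure.le_map_apply (μ := P) (measurable_cantorValue
    h.isSpread_zeroed.measurable h.isSpread_zeroed.lt_base).aemeasurable exV
  rw [cantorLaw] at h0
  rw [h0, Set.eq_univ_of_forall (s := _ ⁻¹' exV), measure_univ] at hle
  · simp at hle
  · exact fun ω => ⟨_, fun k hk => h.isSpread_zeroed.lt_base k hk ω,
      fun k hk => if_pos hk, rfl⟩

lemma exV_subset_Icc : exV ⊆ Set.Icc 0 1 := by
  rintro x ⟨d, hd, -, rfl⟩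
  exact cantorValue_mem_Icc hd

/-! ### The image of the exceptional set -/

/-- At rank `k + 1 ∈ exPositions`, the cylinder with last digit zero is collapsed by the
distribution function to an interval of length at most `exProb (k + 1) 0`. -/
lemma cantorCDF_sub_le [IsProbabilityMeasure P] (h : IsIndependentDigits exBase exProb P ξ)
    (k m : ℕ) :
    cantorCDF exBase P ξ ((((k + 2) * m : ℕ) + 1) / ((k + 2).factorial : ℝ)) -
      cantorCDF exBase P ξ (((k + 2) * m : ℕ) / ((k + 2).factorial : ℝ)) ≤
        exProb (k + 1) 0 := by
  have := h.isSpread.isProbabilityMeasure_cantorLaw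
  have hm := measurable_cantorValue h.measurable h.lt_base
  set q : ℝ := ((k + 2).factorial : ℝ) with hq
  have hq0 : 0 < q := by positivity
  set a : ℝ := ((k + 2) * m : ℕ) / q with ha
  set b : ℝ := (((k + 2) * m : ℕ) + 1) / q with hb
  have hab : a ≤ b := by
    rw [ha, hb]
    gcongr
    linarith
  simp only [cantorCDF, cdf_eq_real]
  -- There are no atoms, so the right endpoint, where the next cylinder begins, can be dropped.
  have hIic : (cantorLaw exBase P ξ).real (Set.Iic b) ≤
      (cantorLaw exBase P ξ).real (Set.Iic a) + (cantorLaw exBase P ξ).real (Set.Ioo a b) := by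
    have hsplit : Set.Iic b ⊆ (Set.Iic a ∪ Set.Ioo a b) ∪ {b} := by
      intro y hy
      rcases le_or_gt y a with h1 | h1
      · exact Or.inl (Or.inl h1)
      · rcases lt_or_eq_of_le (Set.mem_Iic.mp hy) with h2 | h2
        · exact Or.inl (Or.inr ⟨h1, h2⟩)
        · exact Or.inr h2
    have h0 : (cantorLaw exBase P ξ).real {b} = 0 := by
      rw [measureReal_def, h.isSpread.cantorLaw_singleton, ENNReal.toReal_zero]
    have h1 := (measureReal_mono hsplit (measure_ne_top (cantorLaw exBase P ξ) _)).trans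
      (measureReal_union_le _ _)
    rw [h0, add_zero] at h1
    exact h1.trans (measureReal_union_le _ _)
  have hIoo : (cantorLaw exBase P ξ).real (Set.Ioo a b) ≤ exProb (k + 1) 0 := by
    rw [← h.prob (k + 1) (by omega) 0 (by simp [exBase]), cantorLaw,
      map_measureReal_apply hm measurableSet_Ioo]
    refine measureReal_mono (fun ω hω => ?_) (measure_ne_top _ _)
    have hd : ∀ k, 1 ≤ k → ξ k ω < exBase k := fun k hk => h.lt_base k hk ω
    have h1 := (digitNum_div_le_cantorValue hd (k + 1)).trans_lt hω.2
    have h2 := hω.1.trans_le (cantorValue_le_digitNum_succ_div hd (k + 1))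
    have h1' := (div_lt_div_iff_of_pos_right hq0).mp h1
    have h2' := (div_lt_div_iff_of_pos_right hq0).mp h2
    have h3 : digitNum (fun j => ξ j ω) (k + 1) = (k + 2) * m := by
      have h4 : digitNum (fun j => ξ j ω) (k + 1) < (k + 2) * m + 1 := by exact_mod_cast h1'
      have h5 : (k + 2) * m < digitNum (fun j => ξ j ω) (k + 1) + 1 := by exact_mod_cast h2'
      omega
    have hlt : ξ (k + 1) ω < k + 2 := hd (k + 1) (by omega)
    simp only [digitNum] at h3
    have := congrArg (· % (k + 2)) h3
    simpa [Nat.mod_eq_of_lt hlt] using this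
  linarith

/-- The number of cylinders is negligible against every power of the collapsing factor. -/
lemma tendsto_factorial_mul_rpow {s : ℝ} (hs : 0 < s) :
    Tendsto (fun k : ℕ => (k.factorial : ℝ) * (1 / (10 : ℝ) ^ (10 ^ (10 ^ k) : ℕ)) ^ s) atTop
      (𝓝 0) := by
  have hlim : Tendsto (fun k : ℕ => ((10 : ℝ) ^ k)⁻¹) atTop (𝓝 0) :=
    tendsto_inv_atTop_zero.comp (tendsto_pow_atTop_atTop_of_one_lt (by norm_num))
  have hlarge : ∀ᶠ k : ℕ in atTop, 2 / s ≤ (k : ℝ) :=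
    tendsto_natCast_atTop_atTop.eventually_ge_atTop _
  refine squeeze_zero' (.of_forall fun k => by positivity) ?_ hlim
  filter_upwards [hlarge] with k hk
  -- With `Y = 10 ^ k`, the factorial is at most `10 ^ Y` and the power at most `10 ^ (-s * Y ^ 2)`.
  obtain ⟨Y, hY⟩ : ∃ Y : ℕ, Y = 10 ^ k := ⟨_, rfl⟩
  rw [← hY]
  have hkY : k ≤ Y := hY ▸ (Nat.lt_pow_self (by norm_num)).le
  have hkk : k * k ≤ Y := by
    calc k * k ≤ 2 ^ k * 2 ^ k := Nat.mul_le_mul Nat.lt_two_pow_self.le Nat.lt_two_pow_self.le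
      _ = 4 ^ k := by rw [← mul_pow]; norm_num
      _ ≤ Y := hY ▸ Nat.pow_le_pow_left (by norm_num) k
  have hYY : Y * Y ≤ 10 ^ Y := by
    calc Y * Y ≤ 2 ^ Y * 2 ^ Y := Nat.mul_le_mul Nat.lt_two_pow_self.le Nat.lt_two_pow_self.le
      _ = 4 ^ Y := by rw [← mul_pow]; norm_num
      _ ≤ 10 ^ Y := Nat.pow_le_pow_left (by norm_num) Y
  have hfac : k.factorial ≤ 10 ^ Y := by
    calc k.factorial ≤ k ^ k := Nat.factorial_le_pow k
      _ ≤ (10 ^ k) ^ k := Nat.pow_le_pow_left (Nat.lt_pow_self (by norm_num)).le k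
      _ = 10 ^ (k * k) := (pow_mul 10 k k).symm
      _ ≤ 10 ^ Y := Nat.pow_le_pow_right (by norm_num) hkk
  have hpow : (1 / (10 : ℝ) ^ (10 ^ Y : ℕ)) ^ s ≤ (10 : ℝ) ^ (-(s * (Y * Y : ℝ))) := by
    rw [one_div, ← Real.rpow_natCast, ← Real.rpow_neg (by norm_num),
      ← Real.rpow_mul (by norm_num)]
    refine Real.rpow_le_rpow_of_exponent_le (by norm_num) ?_
    have : ((Y * Y : ℕ) : ℝ) ≤ ((10 ^ Y : ℕ) : ℝ) := by exact_mod_cast hYY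
    rw [Nat.cast_mul] at this
    nlinarith
  have hsY : 2 ≤ s * Y := by
    rw [div_le_iff₀ hs] at hk
    have : (k : ℝ) ≤ Y := by exact_mod_cast hkY
    nlinarith
  calc _ ≤ (10 : ℝ) ^ (Y : ℝ) * (10 : ℝ) ^ (-(s * (Y * Y : ℝ))) := by
        gcongr
        rw [Real.rpow_natCast]
        exact_mod_cast hfac
    _ = (10 : ℝ) ^ ((Y : ℝ) - s * (Y * Y : ℝ)) := by
        rw [← Real.rpow_add (by norm_num), sub_eq_add_neg]
    _ ≤ (10 : ℝ) ^ (-(k : ℝ)) := by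
        refine Real.rpow_le_rpow_of_exponent_le (by norm_num) ?_
        have : (k : ℝ) ≤ Y := by exact_mod_cast hkY
        nlinarith [Nat.cast_nonneg (α := ℝ) Y]
    _ = ((10 : ℝ) ^ k)⁻¹ := by rw [Real.rpow_neg (by norm_num), Real.rpow_natCast]

lemma dimH_image_exV [IsProbabilityMeasure P] (h : IsIndependentDigits exBase exProb P ξ) :
    dimH (cantorCDF exBase P ξ '' exV) = 0 := by
  have hmono : Monotone (cantorCDF exBase P ξ) := monotone_cdf _
  -- The collapsing factor at the exceptional position `10 ^ (n + 1)`.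
  set ρ : ℕ → ℝ := fun n => 1 / (10 : ℝ) ^ (10 ^ (10 ^ (10 ^ (n + 1))) : ℕ) with hρ
  have hexp : Tendsto (fun n : ℕ => 10 ^ (n + 1)) atTop atTop :=
    (tendsto_pow_atTop_atTop_of_one_lt (by norm_num)).comp (tendsto_add_atTop_nat 1)
  have hlim (s : ℝ) (hs : 0 < s) :
      Tendsto (fun n => ((10 ^ (n + 1)).factorial : ℝ) * ρ n ^ s) atTop (𝓝 0) :=
    (tendsto_factorial_mul_rpow hs).comp hexp
  have hρ0 : ∀ n, 0 ≤ ρ n := fun n => by positivity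
  have hρlim : Tendsto ρ atTop (𝓝 0) := by
    refine squeeze_zero hρ0 (fun n => ?_) (hlim 1 one_pos)
    rw [Real.rpow_one]
    refine le_mul_of_one_le_left (hρ0 n) ?_
    exact_mod_cast Nat.one_le_iff_ne_zero.mpr (Nat.factorial_ne_zero _)
  let t (n : ℕ) (m : Fin (10 ^ (n + 1)).factorial) : Set ℝ :=
    Set.Icc
      (cantorCDF exBase P ξ
        (((10 ^ (n + 1) + 1) * (m : ℕ) : ℕ) / ((10 ^ (n + 1) + 1).factorial : ℝ)))
      (cantorCDF exBase P ξ
        ((((10 ^ (n + 1) + 1) * (m : ℕ) : ℕ) + 1) / ((10 ^ (n + 1) + 1).factorial : ℝ)))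
  have ht (n : ℕ) (m) : Metric.ediam (t n m) ≤ ENNReal.ofReal (ρ n) := by
    obtain ⟨k, hk⟩ : ∃ k, 10 ^ (n + 1) = k + 1 :=
      ⟨10 ^ (n + 1) - 1, (Nat.sub_add_cancel (Nat.one_le_pow _ _ (by norm_num))).symm⟩
    have hB : k + 1 ∈ exPositions := ⟨n + 1, by omega, hk.symm⟩
    have hle := cantorCDF_sub_le h k m
    rw [exProb_zero_of_mem hB] at hle
    simp only [t, Real.ediam_Icc, hρ, hk]
    exact ENNReal.ofReal_le_ofReal hle
  have hcover (n : ℕ) : cantorCDF exBase P ξ '' exV ⊆ ⋃ m, t n m := by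
    rintro _ ⟨_, ⟨d, hd, hd0, rfl⟩, rfl⟩
    obtain ⟨k, hk⟩ : ∃ k, 10 ^ (n + 1) = k + 1 :=
      ⟨10 ^ (n + 1) - 1, (Nat.sub_add_cancel (Nat.one_le_pow _ _ (by norm_num))).symm⟩
    have hB : k + 1 ∈ exPositions := ⟨n + 1, by omega, hk.symm⟩
    have hnum : digitNum d (k + 1) = (k + 2) * digitNum d k := by
      rw [digitNum, hd0 _ hB, add_zero]
    have h1 := digitNum_div_le_cantorValue hd (k + 1)
    have h2 := cantorValue_le_digitNum_succ_div hd (k + 1)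
    rw [hnum] at h1 h2
    refine Set.mem_iUnion.mpr ⟨⟨digitNum d k, ?_⟩, ?_⟩
    · rw [hk]
      exact digitNum_lt_factorial hd k
    · simp only [t, hk]
      exact ⟨hmono h1, hmono h2⟩
  refine le_antisymm (ENNReal.le_of_forall_pos_le_add fun s hs _ => ?_) bot_le
  rw [zero_add]
  refine dimH_le_of_hausdorffMeasure_ne_top ?_
  have hs' : (0 : ℝ) < s := hs
  have hr : Tendsto (fun n => ENNReal.ofReal (ρ n)) atTop (𝓝 0) := by
    simpa using ENNReal.tendsto_ofReal hρlim
  have hliminf := Measure.hausdorffMeasure_le_liminf_sum (s : ℝ)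
    (cantorCDF exBase P ξ '' exV) _ hr t (.of_forall ht) (.of_forall hcover)
  have hsum (n : ℕ) : ∑ m, Metric.ediam (t n m) ^ (s : ℝ) ≤
      ENNReal.ofReal (((10 ^ (n + 1)).factorial : ℝ) * ρ n ^ (s : ℝ)) := by
    calc ∑ m, Metric.ediam (t n m) ^ (s : ℝ)
        ≤ Finset.card (Finset.univ : Finset (Fin (10 ^ (n + 1)).factorial)) •
            ENNReal.ofReal (ρ n) ^ (s : ℝ) := Finset.sum_le_card_nsmul _ _ _ fun m _ =>
          ENNReal.rpow_le_rpow (ht n m) hs'.le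
      _ = _ := by
        rw [Finset.card_univ, Fintype.card_fin, nsmul_eq_mul,
          ENNReal.ofReal_mul (Nat.cast_nonneg _), ENNReal.ofReal_natCast,
          ENNReal.ofReal_rpow_of_nonneg (hρ0 n) hs'.le]
  have hzero : Tendsto (fun n => ∑ m, Metric.ediam (t n m) ^ (s : ℝ)) atTop (𝓝 0) := by
    refine tendsto_of_tendsto_of_tendsto_of_le_of_le tendsto_const_nhds ?_
      (fun _ => bot_le) hsum
    simpa using ENNReal.tendsto_ofReal (hlim s hs')
  rw [hzero.liminf_eq] at hliminf
  exact (hliminf.trans_lt ENNReal.zero_lt_top).ne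

lemma not_isDPTransformation [IsProbabilityMeasure P]
    (h : IsIndependentDigits exBase exProb P ξ) :
    ¬ IsDPTransformation (cantorCDF exBase P ξ) := by
  intro hDP
  have := hDP.2 exV exV_subset_Icc
  rw [dimH_exV, dimH_image_exV h] at this
  exact one_ne_zero this

end

lemma isArithmeticBase_exBase : IsArithmeticBase exBase :=
  ⟨2, 1, le_rfl, le_rfl, fun k hk => by simp only [exBase]; omega⟩

end CantorDP

theorem mainTheorem4 :
    -- the random variable of the example exists
    (∃ (Ω : Type) (_ : MeasurableSpace Ω) (P : MeasureTheory.Measure Ω) (ξ : ℕ → Ω → ℕ),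
      MeasureTheory.IsProbabilityMeasure P ∧
      CantorDP.IsIndependentDigits CantorDP.exBase CantorDP.exProb P ξ) ∧
    -- its properties
    (∀ k, 1 ≤ k → ∀ i, i < CantorDP.exBase k → 0 < CantorDP.exProb k i) ∧
    dimH CantorDP.exV = 1 ∧
    (∀ (Ω : Type*) [MeasurableSpace Ω] (P : MeasureTheory.Measure Ω)
      [MeasureTheory.IsProbabilityMeasure P] (ξ : ℕ → Ω → ℕ),
      CantorDP.IsIndependentDigits CantorDP.exBase CantorDP.exProb P ξ →
        CantorDP.measureDim (CantorDP.cantorLaw CantorDP.exBase P ξ) = 1 ∧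
        dimH (CantorDP.cantorCDF CantorDP.exBase P ξ '' CantorDP.exV) = 0 ∧
        ¬ CantorDP.IsDPTransformation (CantorDP.cantorCDF CantorDP.exBase P ξ)) ∧
    -- the two necessary conditions are not sufficient for arithmetic Cantor expansions
    (¬ ∀ (n : ℕ → ℕ) (p : ℕ → ℕ → ℝ) (Ω : Type) [MeasurableSpace Ω]
      (P : MeasureTheory.Measure Ω) [MeasureTheory.IsProbabilityMeasure P] (ξ : ℕ → Ω → ℕ),
      CantorDP.IsArithmeticBase n →
      CantorDP.IsIndependentDigits n p P ξ →
      (∀ k, 1 ≤ k → ∀ i, i < n k → 0 < p k i) →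
      CantorDP.measureDim (CantorDP.cantorLaw n P ξ) = 1 →
      CantorDP.IsDPTransformation (CantorDP.cantorCDF n P ξ)) := by
  refine ⟨CantorDP.exists_isIndependentDigits, fun k hk i _ => CantorDP.exProb_pos hk i,
    CantorDP.dimH_exV, fun Ω _ P _ ξ h => ⟨h.isSpread.measureDim_cantorLaw,
      CantorDP.dimH_image_exV h, CantorDP.not_isDPTransformation h⟩, fun H => ?_⟩
  obtain ⟨Ω, mΩ, P, ξ, hP, h⟩ := CantorDP.exists_isIndependentDigits
  exact CantorDP.not_isDPTransformation h (H CantorDP.exBase CantorDP.exProb Ω P ξ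
    CantorDP.isArithmeticBase_exBase h (fun k hk i _ => CantorDP.exProb_pos hk i)
    h.isSpread.measureDim_cantorLaw)
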